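/- Let $K$ be an arbitrary field. The \emph{product rank} of a form $f$ of degree $d$ over $K$ is the smallest number $r$ such that $f$ is a sum of $r$ products of $d$ linear forms over $K$. The \emph{tensor rank} of a tensor is the smallest number of simple tensors summing to it. Let \[ \det\nolimits_3=\det (x_{ij})_{1\le i,j\le 3}\in K[x_{11},\dots,x_{33}] \] be the determinant of the generic $3\times 3$ matrix, a form of degree $3$ in nine variables. As a tensor it is $\sum_{\sigma\in S_3}\operatorname{sgn}(\sigma)\, e_{\sigma(1)}\otimes e_{\sigma(2)}\otimes e_{\sigma(3)}\in K^3\otimes K^3\otimes K^3$. Then: 1. the product rank of $\det_3$ is equal to $5$; 2. the tensor rank of $\det_3$ is equal to $5$; 3. if $K$ is algebraically closed, then the Fano scheme $\mathbf{F}_5(X_{4,3})$ of projective $5$-planes in the hypersurface \[ X_{4,3}=V\Big(\sum_{i=1}^4 x_{i1}x_{i2}x_{i3}\Big)\subset\mathbb{P}^{11} \] is two-split: for every $5$-plane $L\subset X_{4,3}$ there is a set $A\subseteq\{1,2,3,4\}$ with $1\le |A|\le 2$ such that $L\subset V\big(\sum_{i\in A}x_{i1}x_{i2}x_{i3}\big)$.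 -/

import Mathlib

open scoped TensorProduct

/-- The product rank (Chow rank) of a degree `d` form `f`: the least `r` such that `f` is a sum of
`r` products of `d` linear forms (homogeneous polynomials of degree one). -/
noncomputable def productRank {σ K : Type*} [Field K] (d : ℕ) (f : MvPolynomial σ K) : ℕ :=
  sInf {r : ℕ | ∃ l : Fin r → Fin d → MvPolynomial σ K,
    (∀ i j, (l i j).IsHomogeneous 1) ∧ f = ∑ i, ∏ j, l i j}

/-- The tensor rank of `t ∈ ⨂ᵢ V i`: the least `r` such that `t` is a sum of `r` simple tensors.
The index type is nonempty, so that scalar multiples of simple tensors are simple. -/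
noncomputable def tensorRank {ι K : Type*} [Nonempty ι] [Field K] {V : ι → Type*}
    [∀ i, AddCommGroup (V i)] [∀ i, Module K (V i)] (t : ⨂[K] i, V i) : ℕ :=
  sInf {r : ℕ | ∃ v : Fin r → (∀ i, V i), t = ∑ p, PiTensorProduct.tprod K (v p)}

/-- The determinant of the generic `n × n` matrix `(x_{ij})`, a form of degree `n`. -/
noncomputable def genericDet (n : ℕ) (K : Type*) [Field K] : MvPolynomial (Fin n × Fin n) K :=
  (Matrix.mvPolynomialX (Fin n) (Fin n) K).det

/-- The `n × n` determinant as a tensor in `(Kⁿ)^{⊗ n}`: the sum over permutations `τ` of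
`sign τ • e_{τ 1} ⊗ ⋯ ⊗ e_{τ n}`. A simple tensor `v₁ ⊗ ⋯ ⊗ vₙ` stands for the
multihomogeneous product `∏ᵢ (∑ⱼ vᵢⱼ x_{ij})` of linear forms, one in each row of variables. -/
noncomputable def detTensor (n : ℕ) (K : Type*) [Field K] : ⨂[K] _ : Fin n, (Fin n → K) :=
  ∑ τ : Equiv.Perm (Fin n), ((Equiv.Perm.sign τ : ℤ) : K) •
    PiTensorProduct.tprod K (fun i => (Pi.single (τ i) 1 : Fin n → K))

/-- The value at the point `x` (with coordinates `x_{ij}`) of the partial sum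
`∑_{i ∈ A} ∏_{j} x_{ij}`. -/
def sumProd {r d : ℕ} {K : Type*} [Field K] (A : Finset (Fin r)) (x : Fin r × Fin d → K) : K :=
  ∑ i ∈ A, ∏ j, x (i, j)

/-- The (projective) `k`-planes of the hypersurface `X_{r,d} = V(∑_{i=1}^r ∏_{j=1}^d x_{ij})` in
`ℙ^{rd-1}`, given as linear subspaces of dimension `k + 1`: the closed points of its Fano scheme
when `K` is algebraically closed. -/
def fanoPlanes (K : Type*) [Field K] (k r d : ℕ) : Set (Submodule K (Fin r × Fin d → K)) :=
  {L | Module.finrank K L = k + 1 ∧ ∀ x ∈ L, sumProd Finset.univ x = 0}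

/-- The plane `L` admits a `lam`-splitting: there are indices `a₁ < ⋯ < a_lam` such that `L` lies in
`V(∑_{i} ∏_j x_{a_i j})`. -/
def AdmitsSplitting {K : Type*} [Field K] {r d : ℕ} (L : Submodule K (Fin r × Fin d → K))
    (lam : ℕ) : Prop :=
  ∃ A : Finset (Fin r), A.card = lam ∧ ∀ x ∈ L, sumProd A x = 0

/-- The Fano scheme of `k`-planes of `X_{r,d}` (over an algebraically closed field `K`) is
`m`-split: each of these planes admits a `lam`-splitting for some `1 ≤ lam ≤ m`. -/
def FanoIsSplit (K : Type*) [Field K] (k r d m : ℕ) : Prop :=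
  ∀ L ∈ fanoPlanes K k r d, ∃ lam : ℕ, 1 ≤ lam ∧ lam ≤ m ∧ AdmitsSplitting L lam

/-!
The main tool is a splitting theorem for vanishing sums `F₁ + F₂ + F₃ + F₄ = 0` of products of three
linear forms on a space of dimension at least six whose twelve factors have no common zero: some
subsum with one or two terms vanishes (`exists_subsum_prodForm_eq_zero`). It is proved with two
observations. A nonzero product of linear forms that is invariant under translation by `w` has all
its factors vanishing at `w` (`mem_commonKer_of_forall_prodForm_eq`), so in a vanishing sum the
common zeros of the factors of all terms but one are zeros of the factors of the last. And
restricting to the kernel of a factor removes a term. In this way a vanishing sum of three nonzero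
products has at most four independent factors
(`exists_ne_zero_mem_commonKer_of_add_add_eq_zero`). Hence in a sum of four terms without vanishing
subsum every factor divides at least two terms, and counting dimensions in this situation leads to a
contradiction (`false_of_shared_factor`). Applied to the coordinates of `K¹²` restricted to a linear
subspace of dimension six, the theorem says that the Fano scheme is two-split.

For the lower bound on the product rank, suppose that the determinant is a sum of at most four
products over an algebraically closed field, with as few terms as possible. It vanishes on the
six-dimensional space of matrices that kill a given vector `v`, and the splitting theorems give a
nonempty subsum of at most two terms that vanishes there. By irreducibility of the variety of
singular matrices the subsum can be chosen independently of `v`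
(`exists_forall_det_eq_zero_sum_eq_zero`), so it vanishes on all singular matrices. Having at most
six factors, it is invariant under some translation, and then it is zero
(`eq_zero_of_forall_det_eq_zero`) and can be dropped, against minimality
(`not_det_eq_sum_prodForm`). Both steps use that the determinant is not invariant under any nonzero
translation (`eq_zero_of_forall_det_add_eq`).

An expression of the determinant tensor with `r` simple tensors gives one of the determinant with
`r` products of linear forms, so the lower bound holds for the tensor rank as well, and for both
upper bounds it suffices to write the tensor as a sum of five simple tensors whose vectors have
integer coefficients (`detTensor_three_eq_sum_five`).
-/

/-! ### Functions that are polynomial on lines -/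

/-- A function on a vector space is *line polynomial* if its restriction to every affine line is a
polynomial in the parameter. This gives a notion of polynomial function that needs no coordinates
and restricts to subspaces. -/
def IsLinePoly (K : Type*) {V : Type*} [Field K] [AddCommGroup V] [Module K V] (f : V → K) : Prop :=
  ∀ v w : V, ∃ p : Polynomial K, ∀ t : K, f (v + t • w) = p.eval t

namespace IsLinePoly

variable {K V : Type*} [Field K] [AddCommGroup V] [Module K V] {f g : V → K}

lemma const (c : K) : IsLinePoly K (fun _ : V => c) :=
  fun _ _ => ⟨Polynomial.C c, fun t => by simp⟩

lemma linear (l : Module.Dual K V) : IsLinePoly K (fun v => l v) :=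
  fun v w => ⟨Polynomial.C (l v) + Polynomial.C (l w) * Polynomial.X, fun t => by
    simp only [map_add, map_smul, smul_eq_mul, Polynomial.eval_add, Polynomial.eval_mul,
      Polynomial.eval_C, Polynomial.eval_X, mul_comm]⟩

lemma add (hf : IsLinePoly K f) (hg : IsLinePoly K g) : IsLinePoly K (fun v => f v + g v) := by
  intro v w
  obtain ⟨p, hp⟩ := hf v w
  obtain ⟨q, hq⟩ := hg v w
  exact ⟨p + q, fun t => by simp [hp, hq]⟩

lemma sub (hf : IsLinePoly K f) (hg : IsLinePoly K g) : IsLinePoly K (fun v => f v - g v) := by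
  intro v w
  obtain ⟨p, hp⟩ := hf v w
  obtain ⟨q, hq⟩ := hg v w
  exact ⟨p - q, fun t => by simp [hp, hq]⟩

lemma mul (hf : IsLinePoly K f) (hg : IsLinePoly K g) : IsLinePoly K (fun v => f v * g v) := by
  intro v w
  obtain ⟨p, hp⟩ := hf v w
  obtain ⟨q, hq⟩ := hg v w
  exact ⟨p * q, fun t => by simp [hp, hq]⟩

lemma sum {ι : Type*} (s : Finset ι) {f : ι → V → K} (h : ∀ i ∈ s, IsLinePoly K (f i)) :
    IsLinePoly K (fun v => ∑ i ∈ s, f i v) := by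
  classical
  induction s using Finset.induction_on with
  | empty => simpa using const (V := V) (0 : K)
  | insert a s ha ih =>
    simp only [Finset.sum_insert ha]
    exact (h a (by simp)).add (ih fun i hi => h i (by simp [hi]))

lemma prod {ι : Type*} (s : Finset ι) {f : ι → V → K} (h : ∀ i ∈ s, IsLinePoly K (f i)) :
    IsLinePoly K (fun v => ∏ i ∈ s, f i v) := by
  classical
  induction s using Finset.induction_on with
  | empty => simpa using const (V := V) (1 : K)
  | insert a s ha ih =>
    simp only [Finset.prod_insert ha]
    exact (h a (by simp)).mul (ih fun i hi => h i (by simp [hi]))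

lemma translate (hf : IsLinePoly K f) (w : V) : IsLinePoly K (fun v => f (v + w)) := by
  intro v u
  obtain ⟨p, hp⟩ := hf (v + w) u
  exact ⟨p, fun t => by rw [← hp, add_right_comm]⟩

/-- Over an infinite field, line polynomial functions have no zero divisors: join a point where the
first factor does not vanish to a point where the second does not. -/
lemma exists_ne_zero_and [Infinite K] (hf : IsLinePoly K f) (hg : IsLinePoly K g)
    {a b : V} (ha : f a ≠ 0) (hb : g b ≠ 0) : ∃ c, f c ≠ 0 ∧ g c ≠ 0 := by
  obtain ⟨p, hp⟩ := hf a (b - a)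
  obtain ⟨q, hq⟩ := hg a (b - a)
  have hp0 : p ≠ 0 := by
    rintro rfl
    exact ha (by simpa using hp 0)
  have hq0 : q ≠ 0 := by
    rintro rfl
    exact hb (by simpa using hq 1)
  by_contra! h
  refine mul_ne_zero hp0 hq0 (Polynomial.funext fun t => ?_)
  by_cases ht : f (a + t • (b - a)) = 0
  · simp [← hp, ht]
  · simp [← hq, h _ ht]

lemma exists_forall_ne_zero [Infinite K] {ι : Type*} (s : Finset ι) {f : ι → V → K}
    (hf : ∀ i ∈ s, IsLinePoly K (f i)) (h : ∀ i ∈ s, ∃ v, f i v ≠ 0) :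
    ∃ v, ∀ i ∈ s, f i v ≠ 0 := by
  classical
  induction s using Finset.induction_on with
  | empty => exact ⟨0, by simp⟩
  | insert a s ha ih =>
    obtain ⟨b, hb⟩ := ih (fun i hi => hf i (by simp [hi])) (fun i hi => h i (by simp [hi]))
    obtain ⟨c, hc⟩ := h a (by simp)
    obtain ⟨v, hv, hv'⟩ := exists_ne_zero_and (hf a (by simp))
      (prod s fun i hi => hf i (by simp [hi])) hc (Finset.prod_ne_zero_iff.2 hb)
    refine ⟨v, fun i hi => ?_⟩
    rcases Finset.mem_insert.1 hi with rfl | hi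
    · exact hv
    · exact Finset.prod_ne_zero_iff.1 hv' i hi

end IsLinePoly

/-! ### Products of three linear forms -/

section ProdForm

variable {K V : Type*} [Field K] [AddCommGroup V] [Module K V]

/-- The product of three linear forms, as a function. -/
def prodForm (l : Fin 3 → Module.Dual K V) (v : V) : K := ∏ j, l j v

/-- The common kernel of three linear forms. -/
def commonKer (l : Fin 3 → Module.Dual K V) : Submodule K V := ⨅ j, LinearMap.ker (l j)

/-- The restriction of three linear forms to a subspace. -/
def restrictForms (l : Fin 3 → Module.Dual K V) (S : Submodule K V) : Fin 3 → Module.Dual K S :=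
  fun j => (l j).domRestrict S

lemma mem_commonKer {l : Fin 3 → Module.Dual K V} {v : V} :
    v ∈ commonKer l ↔ ∀ j, l j v = 0 := by
  simp [commonKer]

@[simp] lemma prodForm_restrictForms (l : Fin 3 → Module.Dual K V) (S : Submodule K V) (v : S) :
    prodForm (restrictForms l S) v = prodForm l v := rfl

lemma mem_commonKer_restrictForms {l : Fin 3 → Module.Dual K V} {S : Submodule K V} {v : S} :
    v ∈ commonKer (restrictForms l S) ↔ (v : V) ∈ commonKer l := by
  simp only [mem_commonKer]; rfl

lemma isLinePoly_prodForm (l : Fin 3 → Module.Dual K V) : IsLinePoly K (prodForm l) :=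
  IsLinePoly.prod _ fun j _ => IsLinePoly.linear (l j)

lemma prodForm_add_of_mem {l : Fin 3 → Module.Dual K V} {w : V} (hw : w ∈ commonKer l) (v : V) :
    prodForm l (v + w) = prodForm l v := by
  simp [prodForm, mem_commonKer.1 hw]

lemma prodForm_add_smul_of_mem {l : Fin 3 → Module.Dual K V} {w : V} (hw : w ∈ commonKer l)
    (v : V) (t : K) : prodForm l (v + t • w) = prodForm l v :=
  prodForm_add_of_mem (Submodule.smul_mem _ t hw) v

lemma prodForm_eq_zero_of_mem_ker {l : Fin 3 → Module.Dual K V} {j : Fin 3} {v : V}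
    (hv : v ∈ LinearMap.ker (l j)) : prodForm l v = 0 :=
  Finset.prod_eq_zero (Finset.mem_univ j) hv

/-- If a product of linear forms is constant and nonzero along a line, then each of its factors is
constant along this line: a factor that is not would vanish somewhere on it. -/
lemma mem_commonKer_of_forall_prodForm_eq {l : Fin 3 → Module.Dual K V} {v w : V}
    (hv : prodForm l v ≠ 0) (h : ∀ t : K, prodForm l (v + t • w) = prodForm l v) :
    w ∈ commonKer l := by
  rw [mem_commonKer]
  intro j
  by_contra hj
  refine hv ?_
  rw [← h (-(l j v) / l j w)]
  exact Finset.prod_eq_zero (Finset.mem_univ j) (by simp [hj])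

lemma finrank_le_finrank_inf_ker_add_one [FiniteDimensional K V] (S : Submodule K V)
    (f : Module.Dual K V) :
    Module.finrank K S ≤ Module.finrank K (S ⊓ LinearMap.ker f : Submodule K V) + 1 := by
  have h := LinearMap.finrank_range_add_finrank_ker (f.domRestrict S)
  have h1 : Module.finrank K (LinearMap.range (f.domRestrict S)) ≤ 1 := by
    simpa using Submodule.finrank_le (LinearMap.range (f.domRestrict S))
  have h2 : Module.finrank K (LinearMap.ker (f.domRestrict S)) ≤
      Module.finrank K (S ⊓ LinearMap.ker f : Submodule K V) := by
    rw [← Submodule.finrank_map_subtype_eq S]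
    refine Submodule.finrank_mono ?_
    rintro _ ⟨x, hx, rfl⟩
    exact ⟨x.2, hx⟩
  omega

lemma finrank_le_finrank_ker_add_one [FiniteDimensional K V] (f : Module.Dual K V) :
    Module.finrank K V ≤ Module.finrank K (LinearMap.ker f) + 1 := by
  have := finrank_le_finrank_inf_ker_add_one ⊤ f
  rwa [finrank_top, top_inf_eq] at this

lemma finrank_le_finrank_inf_commonKer_add_three [FiniteDimensional K V] (S : Submodule K V)
    (l : Fin 3 → Module.Dual K V) :
    Module.finrank K S ≤ Module.finrank K (S ⊓ commonKer l : Submodule K V) + 3 := by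
  have h0 := finrank_le_finrank_inf_ker_add_one S (l 0)
  have h1 := finrank_le_finrank_inf_ker_add_one (S ⊓ LinearMap.ker (l 0)) (l 1)
  have h2 := finrank_le_finrank_inf_ker_add_one
    (S ⊓ LinearMap.ker (l 0) ⊓ LinearMap.ker (l 1)) (l 2)
  have h : S ⊓ commonKer l =
      S ⊓ LinearMap.ker (l 0) ⊓ LinearMap.ker (l 1) ⊓ LinearMap.ker (l 2) := by
    ext v
    simp [mem_commonKer, Fin.forall_fin_succ, and_assoc]
  rw [h]
  omega

lemma finrank_le_finrank_commonKer_add_three [FiniteDimensional K V]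
    (l : Fin 3 → Module.Dual K V) :
    Module.finrank K V ≤ Module.finrank K (commonKer l) + 3 := by
  have := finrank_le_finrank_inf_commonKer_add_three ⊤ l
  rwa [finrank_top, top_inf_eq] at this

lemma exists_ne_zero_of_finrank_pos {S : Submodule K V} (h : 0 < Module.finrank K S) :
    ∃ v ∈ S, v ≠ 0 := by
  refine (Submodule.ne_bot_iff S).1 ?_
  rintro rfl
  simp at h

lemma ker_le_ker_symm {f g : Module.Dual K V} (h : LinearMap.ker f ≤ LinearMap.ker g)
    (hg : g ≠ 0) : LinearMap.ker g ≤ LinearMap.ker f := by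
  obtain ⟨c, rfl⟩ : ∃ c : K, c • f = g := by
    have := (mem_span_of_iInf_ker_le_ker (L := fun _ : Unit => f) (K := g) (by simpa using h))
    simpa [Submodule.mem_span_singleton] using this
  intro v hv
  have hc : c ≠ 0 := by
    rintro rfl
    simp at hg
  simpa [hc] using hv

/-- If a product of nonzero linear forms vanishes on the kernel of a linear form, then one of the
factors has the same kernel. -/
lemma exists_ker_eq_of_prodForm_eq_zero [Infinite K] {l : Fin 3 → Module.Dual K V}
    {f : Module.Dual K V} (hl : ∀ j, l j ≠ 0) (h : ∀ v ∈ LinearMap.ker f, prodForm l v = 0) :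
    ∃ j, LinearMap.ker (l j) = LinearMap.ker f := by
  by_contra! hne
  have key : ∀ j ∈ Finset.univ, ∃ v : LinearMap.ker f, l j v ≠ 0 := by
    intro j _
    by_contra! hj
    have hle : LinearMap.ker f ≤ LinearMap.ker (l j) := fun v hv => hj ⟨v, hv⟩
    exact hne j (le_antisymm (ker_le_ker_symm hle (hl j)) hle)
  obtain ⟨v, hv⟩ := IsLinePoly.exists_forall_ne_zero Finset.univ
    (f := fun j (v : LinearMap.ker f) => l j v)
    (fun j _ => IsLinePoly.linear ((l j).domRestrict (LinearMap.ker f))) key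
  exact Finset.prod_ne_zero_iff.2 hv (h v v.2)

lemma ne_zero_of_prodForm_ne_zero {l : Fin 3 → Module.Dual K V} (h : ∃ v, prodForm l v ≠ 0)
    (j : Fin 3) : l j ≠ 0 := by
  rintro hj
  obtain ⟨v, hv⟩ := h
  exact hv (Finset.prod_eq_zero (Finset.mem_univ j) (by simp [hj]))

end ProdForm

/-! ### Vanishing sums of three and of four products of linear forms -/

section VanishingSums

variable {K V : Type*} [Field K] [AddCommGroup V] [Module K V]

/-- Since the three products sum to zero, one of them is invariant under all translations that
leave the other two invariant. -/
lemma mem_commonKer_of_add_add_eq_zero {l₁ l₂ l₃ : Fin 3 → Module.Dual K V}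
    (h₁ : ∃ v, prodForm l₁ v ≠ 0)
    (hsum : ∀ v, prodForm l₁ v + prodForm l₂ v + prodForm l₃ v = 0) {w : V}
    (h₂ : w ∈ commonKer l₂) (h₃ : w ∈ commonKer l₃) : w ∈ commonKer l₁ := by
  obtain ⟨v, hv⟩ := h₁
  refine mem_commonKer_of_forall_prodForm_eq hv fun t => ?_
  have := hsum (v + t • w)
  rw [prodForm_add_smul_of_mem h₂, prodForm_add_smul_of_mem h₃] at this
  linear_combination this - hsum v

lemma mem_commonKer_of_add_add_add_eq_zero {l₁ l₂ l₃ l₄ : Fin 3 → Module.Dual K V}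
    (h₁ : ∃ v, prodForm l₁ v ≠ 0)
    (hsum : ∀ v, prodForm l₁ v + prodForm l₂ v + prodForm l₃ v + prodForm l₄ v = 0) {w : V}
    (h₂ : w ∈ commonKer l₂) (h₃ : w ∈ commonKer l₃) (h₄ : w ∈ commonKer l₄) :
    w ∈ commonKer l₁ := by
  obtain ⟨v, hv⟩ := h₁
  refine mem_commonKer_of_forall_prodForm_eq hv fun t => ?_
  have := hsum (v + t • w)
  rw [prodForm_add_smul_of_mem h₂, prodForm_add_smul_of_mem h₃, prodForm_add_smul_of_mem h₄]
    at this
  linear_combination this - hsum v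

/-- Two products that are opposite on the kernel of `f`, and not zero there, are killed by the same
vectors of this kernel. -/
lemma mem_commonKer_of_add_eq_zero_on_ker {l₃ l₄ : Fin 3 → Module.Dual K V} {f : Module.Dual K V}
    (h : ∀ v ∈ LinearMap.ker f, prodForm l₃ v + prodForm l₄ v = 0)
    (h₃ : ∃ v ∈ LinearMap.ker f, prodForm l₃ v ≠ 0) {w : V}
    (hw : w ∈ LinearMap.ker f) (hw₃ : w ∈ commonKer l₃) : w ∈ commonKer l₄ := by
  obtain ⟨v, hv, hv₃⟩ := h₃
  have hv4 := h v hv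
  refine mem_commonKer_of_forall_prodForm_eq (v := v) (fun h0 => hv₃ ?_) fun t => ?_
  · simpa [h0] using hv4
  · have := h (v + t • w) (add_mem hv (Submodule.smul_mem _ t hw))
    rw [prodForm_add_smul_of_mem hw₃] at this
    linear_combination this - hv4

/-- Three nonzero products of three linear forms that sum to zero on a space of dimension at least
five do not involve all coordinates. Otherwise, on the kernel of a factor of the first product the
second and the third are opposite, and if nonzero they would have at most four independent factors
there; so every factor of the first product also divides the second. -/
lemma exists_ne_zero_mem_commonKer_of_add_add_eq_zero [Infinite K] [FiniteDimensional K V]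
    (hV : 5 ≤ Module.finrank K V) {l₁ l₂ l₃ : Fin 3 → Module.Dual K V}
    (h₁ : ∃ v, prodForm l₁ v ≠ 0) (h₂ : ∃ v, prodForm l₂ v ≠ 0)
    (h₃ : ∃ v, prodForm l₃ v ≠ 0)
    (hsum : ∀ v, prodForm l₁ v + prodForm l₂ v + prodForm l₃ v = 0) :
    ∃ w, w ≠ 0 ∧ w ∈ commonKer l₁ ∧ w ∈ commonKer l₂ ∧ w ∈ commonKer l₃ := by
  by_contra! hN
  have hd := finrank_le_finrank_commonKer_add_three l₂
  have hdiv : ∀ j, ∀ v ∈ LinearMap.ker (l₁ j), prodForm l₂ v = 0 := by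
    by_contra! hj
    obtain ⟨j, v, hv, hv₂⟩ := hj
    have hd' := finrank_le_finrank_inf_ker_add_one (commonKer l₂) (l₁ j)
    obtain ⟨w, ⟨hw₂, hw⟩, hw0⟩ := exists_ne_zero_of_finrank_pos
      (S := commonKer l₂ ⊓ LinearMap.ker (l₁ j)) (by omega)
    have hw₃ : w ∈ commonKer l₃ := by
      refine mem_commonKer_of_add_eq_zero_on_ker (fun u hu => ?_) ⟨v, hv, hv₂⟩ hw hw₂
      simpa [prodForm_eq_zero_of_mem_ker hu] using hsum u
    exact hN w hw0 (mem_commonKer_of_add_add_eq_zero h₁ hsum hw₂ hw₃) hw₂ hw₃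
  have hle : commonKer l₂ ≤ commonKer l₁ := by
    intro w hw
    refine mem_commonKer.2 fun j => ?_
    obtain ⟨i, hi⟩ := exists_ker_eq_of_prodForm_eq_zero (ne_zero_of_prodForm_ne_zero h₂) (hdiv j)
    have : w ∈ LinearMap.ker (l₁ j) := hi ▸ mem_commonKer.1 hw i
    exact this
  obtain ⟨w, hw, hw0⟩ := exists_ne_zero_of_finrank_pos (S := commonKer l₂) (by omega)
  refine hN w hw0 (hle hw) hw (mem_commonKer_of_add_add_eq_zero h₃ (l₂ := l₁) (l₃ := l₂) ?_
    (hle hw) hw)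
  intro v
  linear_combination hsum v

/-- If four products of three linear forms sum to zero on a space of dimension at least six and
involve all coordinates, then every factor of the first divides one of the others. -/
lemma exists_forall_ker_prodForm_eq_zero [Infinite K] [FiniteDimensional K V]
    (hV : 6 ≤ Module.finrank K V) {l₁ l₂ l₃ l₄ : Fin 3 → Module.Dual K V}
    (h₁ : ∃ v, prodForm l₁ v ≠ 0)
    (hsum : ∀ v, prodForm l₁ v + prodForm l₂ v + prodForm l₃ v + prodForm l₄ v = 0)
    (hN : ∀ w, w ∈ commonKer l₁ → w ∈ commonKer l₂ → w ∈ commonKer l₃ → w ∈ commonKer l₄ → w = 0)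
    (j : Fin 3) :
    (∀ v ∈ LinearMap.ker (l₁ j), prodForm l₂ v = 0) ∨
    (∀ v ∈ LinearMap.ker (l₁ j), prodForm l₃ v = 0) ∨
    (∀ v ∈ LinearMap.ker (l₁ j), prodForm l₄ v = 0) := by
  by_contra! h
  obtain ⟨⟨v₂, hv₂, hv₂'⟩, ⟨v₃, hv₃, hv₃'⟩, ⟨v₄, hv₄, hv₄'⟩⟩ := h
  have hd := finrank_le_finrank_ker_add_one (l₁ j)
  obtain ⟨w, hw0, hw₂, hw₃, hw₄⟩ := exists_ne_zero_mem_commonKer_of_add_add_eq_zero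
    (V := LinearMap.ker (l₁ j)) (by omega)
    (l₁ := restrictForms l₂ _) (l₂ := restrictForms l₃ _) (l₃ := restrictForms l₄ _)
    ⟨⟨v₂, hv₂⟩, hv₂'⟩ ⟨⟨v₃, hv₃⟩, hv₃'⟩ ⟨⟨v₄, hv₄⟩, hv₄'⟩ (fun v => by
      simpa [prodForm_eq_zero_of_mem_ker v.2] using hsum v)
  rw [mem_commonKer_restrictForms] at hw₂ hw₃ hw₄
  refine hw0 (Subtype.ext (hN w ?_ hw₂ hw₃ hw₄))
  exact mem_commonKer_of_add_add_add_eq_zero h₁ hsum hw₂ hw₃ hw₄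

/-- If three nonzero linear forms have the same kernels as three others, up to a permutation, then
the products are proportional. -/
lemma exists_prodForm_eq_smul_of_ker_eq {l₁ l₂ : Fin 3 → Module.Dual K V} {τ : Fin 3 → Fin 3}
    (hτ : Function.Injective τ)
    (h : ∀ j, LinearMap.ker (l₂ (τ j)) = LinearMap.ker (l₁ j)) :
    ∃ c : K, ∀ v, prodForm l₁ v = c * prodForm l₂ v := by
  have hc : ∀ j, ∃ c : K, c • l₂ (τ j) = l₁ j := by
    intro j
    have := mem_span_of_iInf_ker_le_ker (L := fun _ : Unit => l₂ (τ j)) (K := l₁ j)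
      (by simpa using (h j).le)
    simpa [Submodule.mem_span_singleton] using this
  choose c hc using hc
  refine ⟨∏ j, c j, fun v => ?_⟩
  have hb : Function.Bijective τ := Finite.injective_iff_bijective.1 hτ
  rw [prodForm, prodForm, ← hb.prod_comp (fun j => l₂ j v), ← Finset.prod_mul_distrib]
  exact Finset.prod_congr rfl fun j _ => by rw [← hc j]; rfl

/-- The configuration of a vanishing sum of four products in which the first two products, but not
the third, share a factor `l₁ j₀`. On the kernel of this factor the last two products are opposite,
so at least two dimensions `M` of it are killed by all their factors. The remaining factors of the
first two products are independent on `M`, so each factor of the first product must divide the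
second one, and the two products are proportional. Then the sum of the last two is a multiple of the
second, which however is not invariant under translation by `M`. -/
lemma false_of_shared_factor [Infinite K] [FiniteDimensional K V]
    (hV : 6 ≤ Module.finrank K V) {l₁ l₂ l₃ l₄ : Fin 3 → Module.Dual K V}
    (h₁ : ∃ v, prodForm l₁ v ≠ 0) (h₂ : ∃ v, prodForm l₂ v ≠ 0)
    (h₃ : ∃ v, prodForm l₃ v ≠ 0) (h₄ : ∃ v, prodForm l₄ v ≠ 0)
    (hsum : ∀ v, prodForm l₁ v + prodForm l₂ v + prodForm l₃ v + prodForm l₄ v = 0)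
    (h₃₄ : ∃ v, prodForm l₃ v + prodForm l₄ v ≠ 0)
    (hN : ∀ w, w ∈ commonKer l₁ → w ∈ commonKer l₂ → w ∈ commonKer l₃ → w ∈ commonKer l₄ → w = 0)
    {j₀ : Fin 3} (hj₀ : ∀ v ∈ LinearMap.ker (l₁ j₀), prodForm l₂ v = 0)
    (hj₀' : ∃ v ∈ LinearMap.ker (l₁ j₀), prodForm l₃ v ≠ 0) : False := by
  let M : Submodule K V := commonKer l₃ ⊓ LinearMap.ker (l₁ j₀)
  have hdM : 2 ≤ Module.finrank K M := by
    have h3 := finrank_le_finrank_commonKer_add_three l₃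
    have h4 := finrank_le_finrank_inf_ker_add_one (commonKer l₃) (l₁ j₀)
    change 2 ≤ Module.finrank K (commonKer l₃ ⊓ LinearMap.ker (l₁ j₀) : Submodule K V)
    omega
  have hM₃ : ∀ w ∈ M, w ∈ commonKer l₃ := fun w hw => hw.1
  have hM₄ : ∀ w ∈ M, w ∈ commonKer l₄ := fun w hw => by
    refine mem_commonKer_of_add_eq_zero_on_ker (fun v hv => ?_) hj₀' hw.2 hw.1
    simpa [prodForm_eq_zero_of_mem_ker hv, hj₀ v hv] using hsum v
  have hM₁ : ∀ w ∈ M, w ∈ commonKer l₁ → w = 0 := fun w hw hw₁ => by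
    refine hN w hw₁ ?_ (hM₃ w hw) (hM₄ w hw)
    refine mem_commonKer_of_add_add_add_eq_zero h₂ (fun v => ?_) hw₁ (hM₃ w hw) (hM₄ w hw)
    linear_combination hsum v
  have hM₂ : ∀ w ∈ M, w ∈ commonKer l₂ → w = 0 := fun w hw hw₂ =>
    hM₁ w hw (mem_commonKer_of_add_add_add_eq_zero h₁ hsum hw₂ (hM₃ w hw) (hM₄ w hw))
  -- a single further equation does not cut `M` down to the common kernel of the first product
  have hind : ∀ p, ∃ w ∈ M, l₁ p w = 0 ∧ ∃ q, l₁ q w ≠ 0 := by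
    intro p
    have hd := finrank_le_finrank_inf_ker_add_one M (l₁ p)
    obtain ⟨w, ⟨hw, hwp⟩, hw0⟩ := exists_ne_zero_of_finrank_pos
      (S := M ⊓ LinearMap.ker (l₁ p)) (by omega)
    refine ⟨w, hw, hwp, ?_⟩
    by_contra! h
    exact hw0 (hM₁ w hw (mem_commonKer.2 h))
  have hthird : ∀ j : Fin 3, j ≠ j₀ → ∃ p, ∀ q, q = j₀ ∨ q = j ∨ q = p := by
    clear * -
    revert j₀; decide
  have hnot : ∀ j, j ≠ j₀ → ¬ M ≤ LinearMap.ker (l₁ j) := by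
    intro j hj hle
    obtain ⟨p, hp⟩ := hthird j hj
    obtain ⟨w, hw, hwp, q, hq⟩ := hind p
    rcases hp q with rfl | rfl | rfl
    · exact hq hw.2
    · exact hq (hle hw)
    · exact hq hwp
  have hzero : ∀ l : Fin 3 → Module.Dual K V, (∀ w ∈ M, w ∈ commonKer l) →
      (∃ v, prodForm l v ≠ 0) → ∀ j, j ≠ j₀ →
      ¬ ∀ v ∈ LinearMap.ker (l₁ j), prodForm l v = 0 := by
    intro l hl hl0 j hj h
    obtain ⟨i, hi⟩ := exists_ker_eq_of_prodForm_eq_zero (ne_zero_of_prodForm_ne_zero hl0) h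
    exact hnot j hj fun w hw => hi ▸ mem_commonKer.1 (hl w hw) i
  have hdiv : ∀ j, ∀ v ∈ LinearMap.ker (l₁ j), prodForm l₂ v = 0 := by
    intro j
    by_cases hj : j = j₀
    · exact hj ▸ hj₀
    · rcases exists_forall_ker_prodForm_eq_zero hV h₁ hsum hN j with h | h | h
      · exact h
      · exact (hzero l₃ hM₃ h₃ j hj h).elim
      · exact (hzero l₄ hM₄ h₄ j hj h).elim
  choose τ hτ using fun j =>
    exists_ker_eq_of_prodForm_eq_zero (ne_zero_of_prodForm_ne_zero h₂) (hdiv j)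
  have hinj : Function.Injective τ := by
    intro j j' hjj
    by_contra hne
    have hker : LinearMap.ker (l₁ j) = LinearMap.ker (l₁ j') := by rw [← hτ, ← hτ, hjj]
    by_cases hj : j = j₀
    · subst hj
      exact hnot j' (Ne.symm hne) fun w hw => hker ▸ hw.2
    · by_cases hj' : j' = j₀
      · subst hj'
        exact hnot j hne fun w hw => hker ▸ hw.2
      · obtain ⟨w, hw, hwj, q, hq⟩ := hind j
        have hwj' : w ∈ LinearMap.ker (l₁ j') := hker ▸ hwj
        have hcases : q = j₀ ∨ q = j ∨ q = j' := by
          clear * - hne hj hj'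
          revert q j j' j₀; decide
        rcases hcases with rfl | rfl | rfl
        · exact hq hw.2
        · exact hq hwj
        · exact hq hwj'
  obtain ⟨c, hc⟩ := exists_prodForm_eq_smul_of_ker_eq hinj hτ
  have h34 : ∀ v, prodForm l₃ v + prodForm l₄ v = -(c + 1) * prodForm l₂ v := fun v => by
    linear_combination hsum v - hc v
  have hc1 : c + 1 ≠ 0 := by
    intro h0
    obtain ⟨v, hv⟩ := h₃₄
    exact hv (by simp [h34, h0])
  obtain ⟨v, hv⟩ := h₂
  obtain ⟨w, hw, hw0⟩ := exists_ne_zero_of_finrank_pos (S := M) (by omega)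
  refine hw0 (hM₂ w hw (mem_commonKer_of_forall_prodForm_eq hv fun t => ?_))
  have h := h34 (v + t • w)
  rw [prodForm_add_smul_of_mem (hM₃ w hw), prodForm_add_smul_of_mem (hM₄ w hw), h34 v] at h
  exact (mul_left_cancel₀ (neg_ne_zero.2 hc1) h).symm

/-- **Splitting of vanishing sums of four products.** If four products of three linear forms sum to
zero on a space of dimension at least six, and the twelve linear forms have no common zero, then
some subsum with one or two terms vanishes. -/
theorem exists_subsum_prodForm_eq_zero [Infinite K] [FiniteDimensional K V]
    (hV : 6 ≤ Module.finrank K V) (l : Fin 4 → Fin 3 → Module.Dual K V)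
    (hsum : ∀ v, ∑ i, prodForm (l i) v = 0)
    (hN : ∀ w, (∀ i, w ∈ commonKer (l i)) → w = 0) :
    ∃ A : Finset (Fin 4), 1 ≤ A.card ∧ A.card ≤ 2 ∧ ∀ v, ∑ i ∈ A, prodForm (l i) v = 0 := by
  by_contra! hA
  have hne : ∀ i, ∃ v, prodForm (l i) v ≠ 0 := fun i => by
    simpa using hA {i} (by simp) (by simp)
  have hpair : ∀ c d, c ≠ d → ∃ v, prodForm (l c) v + prodForm (l d) v ≠ 0 := fun c d hcd => by
    simpa [Finset.sum_pair hcd] using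
      hA {c, d} (by simp [Finset.card_pair hcd]) (by simp [Finset.card_pair hcd])
  have huniv : ∀ a b c d : Fin 4, a ≠ b → a ≠ c → a ≠ d → b ≠ c → b ≠ d → c ≠ d →
      ∀ i, i = a ∨ i = b ∨ i = c ∨ i = d := by decide
  have hsum4 : ∀ a b c d : Fin 4, a ≠ b → a ≠ c → a ≠ d → b ≠ c → b ≠ d → c ≠ d →
      ∀ v, prodForm (l a) v + prodForm (l b) v + prodForm (l c) v + prodForm (l d) v = 0 := by
    intro a b c d hab hac had hbc hbd hcd v
    have hu : (Finset.univ : Finset (Fin 4)) = {a, b, c, d} := by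
      ext i
      simpa using huniv a b c d hab hac had hbc hbd hcd i
    have := hsum v
    rw [hu, Finset.sum_insert (by simp [hab, hac, had]), Finset.sum_insert (by simp [hbc, hbd]),
      Finset.sum_pair hcd] at this
    linear_combination this
  have hN4 : ∀ a b c d : Fin 4, a ≠ b → a ≠ c → a ≠ d → b ≠ c → b ≠ d → c ≠ d →
      ∀ w, w ∈ commonKer (l a) → w ∈ commonKer (l b) → w ∈ commonKer (l c) →
        w ∈ commonKer (l d) → w = 0 := by
    intro a b c d hab hac had hbc hbd hcd w ha hb hc hd
    refine hN w fun i => ?_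
    rcases huniv a b c d hab hac had hbc hbd hcd i with rfl | rfl | rfl | rfl <;> assumption
  -- a factor shared by two products, but not by all four
  obtain ⟨a, b, c, j, hab, hac, hbc, hb, hc⟩ : ∃ a b c j, a ≠ b ∧ a ≠ c ∧ b ≠ c ∧
      (∀ v ∈ LinearMap.ker (l a j), prodForm (l b) v = 0) ∧
      ∃ v ∈ LinearMap.ker (l a j), prodForm (l c) v ≠ 0 := by
    by_contra! hall
    have hdiv : ∀ a, a ≠ 0 → ∀ j, ∀ v ∈ LinearMap.ker (l a j), prodForm (l 0) v = 0 := by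
      intro a ha j
      obtain ⟨c, d, hac, had, h0c, h0d, hcd⟩ :
          ∃ c d : Fin 4, a ≠ c ∧ a ≠ d ∧ 0 ≠ c ∧ 0 ≠ d ∧ c ≠ d := by
        clear * - ha
        revert a; decide
      rcases exists_forall_ker_prodForm_eq_zero hV (hne a)
        (hsum4 a 0 c d ha hac had h0c h0d hcd) (hN4 a 0 c d ha hac had h0c h0d hcd) j with h | h | h
      · exact h
      · exact hall a c 0 j hac ha h0c.symm h
      · exact hall a d 0 j had ha h0d.symm h
    have hd := finrank_le_finrank_commonKer_add_three (l 0)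
    obtain ⟨w, hw, hw0⟩ := exists_ne_zero_of_finrank_pos (S := commonKer (l 0)) (by omega)
    refine hw0 (hN w fun a => ?_)
    by_cases ha : a = 0
    · exact ha ▸ hw
    refine mem_commonKer.2 fun j => ?_
    obtain ⟨i, hi⟩ :=
      exists_ker_eq_of_prodForm_eq_zero (ne_zero_of_prodForm_ne_zero (hne 0)) (hdiv a ha j)
    have : w ∈ LinearMap.ker (l a j) := hi ▸ mem_commonKer.1 hw i
    exact this
  obtain ⟨d, had, hbd, hcd⟩ : ∃ d : Fin 4, a ≠ d ∧ b ≠ d ∧ c ≠ d := by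
    clear * -
    revert a b c; decide
  exact false_of_shared_factor hV (hne a) (hne b) (hne c) (hne d)
    (hsum4 a b c d hab hac had hbc hbd hcd) (hpair c d hcd)
    (hN4 a b c d hab hac had hbc hbd hcd) hb hc

/-- Over an infinite field, the Fano scheme of projective five-planes of
`V(∑_{i ≤ 4} x_{i1} x_{i2} x_{i3})` is two-split. -/
theorem fanoIsSplit_five_four_three_two (K : Type*) [Field K] [Infinite K] :
    FanoIsSplit K 5 4 3 2 := by
  rintro L ⟨hL, hzero⟩
  let l : Fin 4 → Fin 3 → Module.Dual K L := fun i j => (LinearMap.proj (i, j)).domRestrict L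
  obtain ⟨A, h1, h2, hA⟩ := exists_subsum_prodForm_eq_zero (V := L) (by omega) l
    (fun v => hzero v v.2) (fun w hw => by
      ext ⟨i, j⟩
      exact mem_commonKer.1 (hw i) j)
  exact ⟨A.card, h1, h2, A, rfl, fun x hx => hA ⟨x, hx⟩⟩

end VanishingSums

/-! ### Singular matrices and the determinant -/

section Determinant

variable {K : Type*} [Field K]

/-- The determinant involves all coordinates: it is not invariant under any nonzero translation. -/
lemma eq_zero_of_forall_det_add_eq {w : Matrix (Fin 3) (Fin 3) K}
    (h : ∀ B : Matrix (Fin 3) (Fin 3) K, (B + w).det = B.det) : w = 0 := by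
  -- an entry of `w` is a mixed second difference of the determinant, in the directions of the two
  -- diagonal matrix units of the complementary minor
  have key : ∀ i j, w i j =
      ((Matrix.single (i + 1) (j + 1) 1 + Matrix.single (i + 2) (j + 2) 1) + w).det
      - (Matrix.single (i + 1) (j + 1) 1 + w).det - (Matrix.single (i + 2) (j + 2) 1 + w).det
      + (0 + w).det := by
    intro i j
    fin_cases i <;> fin_cases j <;> simp [Matrix.det_fin_three] <;> ring
  have key0 : ∀ i j : Fin 3,
      ((Matrix.single (i + 1) (j + 1) 1 + Matrix.single (i + 2) (j + 2) 1) :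
        Matrix (Fin 3) (Fin 3) K).det
      - (Matrix.single (i + 1) (j + 1) 1 : Matrix (Fin 3) (Fin 3) K).det
      - (Matrix.single (i + 2) (j + 2) 1 : Matrix (Fin 3) (Fin 3) K).det
      + (0 : Matrix (Fin 3) (Fin 3) K).det = 0 := by
    intro i j
    fin_cases i <;> fin_cases j <;> simp [Matrix.det_fin_three]
  ext i j
  rw [key, h, h, h, h, key0, Matrix.zero_apply]

/-- The subspace of matrices that kill the vector `v`. -/
def annihilating (v : Fin 3 → K) : Submodule K (Matrix (Fin 3) (Fin 3) K) :=
  LinearMap.ker ((Matrix.mulVecBilin K K).flip v)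

lemma mem_annihilating {v : Fin 3 → K} {M : Matrix (Fin 3) (Fin 3) K} :
    M ∈ annihilating v ↔ M.mulVec v = 0 := by
  simp [annihilating]

lemma six_le_finrank_annihilating (v : Fin 3 → K) : 6 ≤ Module.finrank K (annihilating v) := by
  have h := LinearMap.finrank_range_add_finrank_ker
    ((Matrix.mulVecBilin (m := Fin 3) (n := Fin 3) K K).flip v)
  have h1 := Submodule.finrank_le (LinearMap.range
    ((Matrix.mulVecBilin (m := Fin 3) (n := Fin 3) K K).flip v))
  simp [Module.finrank_matrix] at h h1
  change 6 ≤ Module.finrank K (LinearMap.ker ((Matrix.mulVecBilin K K).flip v))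
  omega

/-- The matrix whose rows are the cross products of `v` with the rows of `U`. For `v ≠ 0` these are
all the matrices that kill `v`. -/
def crossRows (v : Fin 3 → K) (U : Fin 3 → Fin 3 → K) : Matrix (Fin 3) (Fin 3) K :=
  Matrix.of fun i => crossProduct v (U i)

lemma crossRows_mulVec (v : Fin 3 → K) (U : Fin 3 → Fin 3 → K) :
    (crossRows v U).mulVec v = 0 := by
  ext i
  rw [Matrix.mulVec, dotProduct_comm]
  exact dot_self_cross v (U i)

lemma exists_crossRows_eq {v : Fin 3 → K} (hv : v ≠ 0) {M : Matrix (Fin 3) (Fin 3) K}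
    (hM : M.mulVec v = 0) : ∃ U, crossRows v U = M := by
  obtain ⟨i, hi⟩ := Function.ne_iff.1 hv
  -- with `a` dual to `v`, each row `r` of `M` is `v × (r × a)`
  let a : Fin 3 → K := Pi.single i (v i)⁻¹
  have ha : dotProduct v a = 1 := by
    simp only [a, dotProduct_single]
    exact mul_inv_cancel₀ hi
  refine ⟨fun k => crossProduct (M k) a, ?_⟩
  ext k j
  have hk : dotProduct (M k) v = 0 := congrFun hM k
  change crossProduct v (crossProduct (M k) a) j = M k j
  rw [cross_cross_eq_smul_sub_smul', ha, hk]
  simp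

lemma isLinePoly_linear_crossRows (l : Module.Dual K (Matrix (Fin 3) (Fin 3) K)) :
    IsLinePoly K (fun p : (Fin 3 → K) × (Fin 3 → Fin 3 → K) => l (crossRows p.1 p.2)) := by
  rintro ⟨v, U⟩ ⟨v', U'⟩
  refine ⟨Polynomial.C (l (crossRows v U)) +
    Polynomial.C (l (crossRows v U' + crossRows v' U)) * Polynomial.X +
    Polynomial.C (l (crossRows v' U')) * Polynomial.X ^ 2, fun t => ?_⟩
  have : crossRows (v + t • v') (U + t • U') =
      crossRows v U + t • (crossRows v U' + crossRows v' U) + t ^ 2 • crossRows v' U' := by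
    ext i j
    simp only [crossRows, Matrix.of_apply, Pi.add_apply, Pi.smul_apply, map_add, map_smul,
      LinearMap.add_apply, LinearMap.smul_apply, Matrix.add_apply, Matrix.smul_apply, smul_eq_mul]
    ring
  simp only [Prod.smul_mk, Prod.mk_add_mk, this, map_add, map_smul, smul_eq_mul,
    Polynomial.eval_add, Polynomial.eval_mul, Polynomial.eval_C, Polynomial.eval_X,
    Polynomial.eval_pow]
  ring

lemma isLinePoly_sum_prodForm_crossRows {ι : Type*}
    (l : ι → Fin 3 → Module.Dual K (Matrix (Fin 3) (Fin 3) K)) (A : Finset ι) :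
    IsLinePoly K (fun p : (Fin 3 → K) × (Fin 3 → Fin 3 → K) =>
      ∑ i ∈ A, prodForm (l i) (crossRows p.1 p.2)) :=
  IsLinePoly.sum _ fun _ _ => IsLinePoly.prod _ fun _ _ => isLinePoly_linear_crossRows _

/-- Irreducibility of the variety of singular matrices: if for every `v ≠ 0` one of finitely many
subsums vanishes on the matrices killing `v`, then one of them vanishes on all singular matrices. -/
lemma exists_forall_det_eq_zero_sum_eq_zero [Infinite K] {ι : Type*}
    (l : ι → Fin 3 → Module.Dual K (Matrix (Fin 3) (Fin 3) K)) (𝒜 : Finset (Finset ι))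
    (h : ∀ v : Fin 3 → K, v ≠ 0 → ∃ A ∈ 𝒜, ∀ M ∈ annihilating v, ∑ i ∈ A, prodForm (l i) M = 0) :
    ∃ A ∈ 𝒜, ∀ M : Matrix (Fin 3) (Fin 3) K, M.det = 0 → ∑ i ∈ A, prodForm (l i) M = 0 := by
  by_contra! hA
  have hex : ∀ A ∈ 𝒜, ∃ p : (Fin 3 → K) × (Fin 3 → Fin 3 → K),
      ∑ i ∈ A, prodForm (l i) (crossRows p.1 p.2) ≠ 0 := by
    intro A hA'
    obtain ⟨M, hM, hne⟩ := hA A hA'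
    obtain ⟨v, hv, hMv⟩ := Matrix.exists_mulVec_eq_zero_iff.2 hM
    obtain ⟨U, rfl⟩ := exists_crossRows_eq hv hMv
    exact ⟨(v, U), hne⟩
  obtain ⟨p, hp⟩ := IsLinePoly.exists_forall_ne_zero 𝒜
    (fun A _ => isLinePoly_sum_prodForm_crossRows l A) hex
  -- the first component of the common point of nonvanishing need not be nonzero
  have hlin : IsLinePoly K (fun p : (Fin 3 → K) × (Fin 3 → Fin 3 → K) => p.1 0) :=
    IsLinePoly.linear ((LinearMap.proj (R := K) (φ := fun _ : Fin 3 => K) 0).comp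
      (LinearMap.fst K (Fin 3 → K) (Fin 3 → Fin 3 → K)))
  obtain ⟨⟨v, U⟩, hq, hv⟩ := IsLinePoly.exists_ne_zero_and
    (IsLinePoly.prod 𝒜 fun A _ => isLinePoly_sum_prodForm_crossRows l A) hlin
    (Finset.prod_ne_zero_iff.2 hp) (b := (fun _ => 1, 0)) one_ne_zero
  obtain ⟨A, hA', hvan⟩ := h v (fun h0 => hv (by simp [h0]))
  exact Finset.prod_ne_zero_iff.1 hq A hA'
    (hvan _ (mem_annihilating.2 (crossRows_mulVec v U)))

/-- A function on matrices that vanishes on the singular ones and is invariant under translations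
along some `w ≠ 0` is zero: a general line in the direction `w` meets the singular matrices. -/
lemma eq_zero_of_forall_det_eq_zero [IsAlgClosed K] {P : Matrix (Fin 3) (Fin 3) K → K}
    (hP : IsLinePoly K P)
    (hdet : IsLinePoly K (Matrix.det : Matrix (Fin 3) (Fin 3) K → K))
    (hsing : ∀ M : Matrix (Fin 3) (Fin 3) K, M.det = 0 → P M = 0)
    {w : Matrix (Fin 3) (Fin 3) K} (hw : w ≠ 0) (hinv : ∀ M (t : K), P (M + t • w) = P M)
    (M : Matrix (Fin 3) (Fin 3) K) : P M = 0 := by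
  by_contra hM
  obtain ⟨B, hB⟩ : ∃ B : Matrix (Fin 3) (Fin 3) K, (B + w).det - B.det ≠ 0 := by
    by_contra! h
    exact hw (eq_zero_of_forall_det_add_eq fun B => sub_eq_zero.1 (h B))
  have : Infinite K := IsAlgClosed.instInfinite
  obtain ⟨C, hC, hC'⟩ := IsLinePoly.exists_ne_zero_and hP ((hdet.translate w).sub hdet) hM hB
  obtain ⟨q, hq⟩ := hdet C w
  by_cases hdeg : q.degree = 0
  · obtain ⟨c, rfl⟩ : ∃ c, q = Polynomial.C c := ⟨_, Polynomial.eq_C_of_degree_eq_zero hdeg⟩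
    have h0 := hq 0
    have h1 := hq 1
    simp only [zero_smul, add_zero, one_smul, Polynomial.eval_C] at h0 h1
    exact hC' (by rw [h0, h1, sub_self])
  · obtain ⟨t, ht⟩ := IsAlgClosed.exists_root q hdeg
    exact hC (by rw [← hinv C t]; exact hsing _ ((hq t).trans ht))

/-- The determinant of `3 × 3` matrices over an algebraically closed field is not a sum of at most
four products of linear forms. In a minimal such expression, some subsum with at most two terms
vanishes on all singular matrices. It involves at most six linear forms, so it is invariant under
some translation, hence zero, which contradicts minimality. -/
theorem not_det_eq_sum_prodForm [IsAlgClosed K] {ι : Type*}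
    (l : ι → Fin 3 → Module.Dual K (Matrix (Fin 3) (Fin 3) K)) (B : Finset ι) (hB : B.card ≤ 4) :
    ¬ ∀ M : Matrix (Fin 3) (Fin 3) K, M.det = ∑ i ∈ B, prodForm (l i) M := by
  classical
  have : Infinite K := IsAlgClosed.instInfinite
  induction B using Finset.strongInduction with
  | H B ih =>
  intro hdet
  have hpoly : ∀ A : Finset ι, IsLinePoly K (fun M => ∑ i ∈ A, prodForm (l i) M) := fun A =>
    IsLinePoly.sum _ fun i _ => isLinePoly_prodForm (l i)
  have hdetpoly : IsLinePoly K (Matrix.det : Matrix (Fin 3) (Fin 3) K → K) := by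
    rw [funext hdet]; exact hpoly B
  have hN : ∀ w, (∀ i ∈ B, w ∈ commonKer (l i)) → w = 0 := fun w hw =>
    eq_zero_of_forall_det_add_eq fun M => by
      rw [hdet, hdet]
      exact Finset.sum_congr rfl fun i hi => prodForm_add_of_mem (hw i hi) M
  -- no short nonempty subsum vanishes on the singular matrices
  have hred : ∀ A ⊆ B, A.Nonempty → A.card ≤ 2 →
      ¬ ∀ M : Matrix (Fin 3) (Fin 3) K, M.det = 0 → ∑ i ∈ A, prodForm (l i) M = 0 := by
    intro A hAB hA hcard hsing
    obtain ⟨i₁, i₂, hi⟩ : ∃ i₁ i₂, ∀ i ∈ A, i = i₁ ∨ i = i₂ := by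
      obtain ⟨a, ha⟩ := hA
      rcases Finset.eq_empty_or_nonempty (A.erase a) with he | ⟨b, hb⟩
      · exact ⟨a, a, fun i hi => by
          by_contra! hne
          exact Finset.notMem_empty i (he ▸ Finset.mem_erase.2 ⟨hne.1, hi⟩)⟩
      · refine ⟨a, b, fun i hi => ?_⟩
        have h1 : (A.erase a).card ≤ 1 := by
          rw [Finset.card_erase_of_mem ha]; omega
        by_cases hia : i = a
        · exact Or.inl hia
        · exact Or.inr (Finset.card_le_one.1 h1 i (Finset.mem_erase.2 ⟨hia, hi⟩) b hb)
    have hd1 := finrank_le_finrank_commonKer_add_three (l i₁)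
    have hd2 := finrank_le_finrank_inf_commonKer_add_three (commonKer (l i₁)) (l i₂)
    have hd3 : Module.finrank K (Matrix (Fin 3) (Fin 3) K) = 9 := by
      simp [Module.finrank_matrix]
    obtain ⟨w, ⟨hw1, hw2⟩, hw0⟩ := exists_ne_zero_of_finrank_pos
      (S := commonKer (l i₁) ⊓ commonKer (l i₂)) (by omega)
    have hzero := eq_zero_of_forall_det_eq_zero (hpoly A) hdetpoly hsing hw0 (fun M t =>
      Finset.sum_congr rfl fun i hiA => by
        rcases hi i hiA with rfl | rfl
        · exact prodForm_add_smul_of_mem hw1 M t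
        · exact prodForm_add_smul_of_mem hw2 M t)
    refine ih (B \ A) (Finset.sdiff_ssubset hAB hA)
      ((Finset.card_le_card Finset.sdiff_subset).trans hB) fun M => ?_
    rw [hdet, ← Finset.sum_sdiff hAB, hzero M, add_zero]
  have hB0 : B.Nonempty := by
    by_contra h
    rw [Finset.not_nonempty_iff_eq_empty] at h
    have := hdet 1
    rw [h, Finset.sum_empty, Matrix.det_one] at this
    exact one_ne_zero this
  have hB2 : ¬ B.card ≤ 2 := fun h =>
    hred B subset_rfl hB0 h fun M hM => by rw [← hdet, hM]
  have hann : ∀ v : Fin 3 → K, v ≠ 0 → ∀ M ∈ annihilating v, ∑ i ∈ B, prodForm (l i) M = 0 :=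
    fun v hv M hM => by
      rw [← hdet]
      exact Matrix.exists_mulVec_eq_zero_iff.1 ⟨v, hv, mem_annihilating.1 hM⟩
  obtain ⟨A, hA, hsing⟩ := exists_forall_det_eq_zero_sum_eq_zero l
    (B.powerset.filter fun A => A.Nonempty ∧ A.card ≤ 2) (fun v hv => by
      have hdim := six_le_finrank_annihilating v
      simp only [Finset.mem_filter, Finset.mem_powerset]
      obtain hB3 | hB4 : B.card = 3 ∨ B.card = 4 := by omega
      · by_contra! h
        have hne : ∀ i ∈ B, ∃ M : annihilating v, prodForm (restrictForms (l i) _) M ≠ 0 := by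
          intro i hi
          obtain ⟨M, hM, hne⟩ := h {i} ⟨by simpa using hi, by simp, by simp⟩
          exact ⟨⟨M, hM⟩, by simpa using hne⟩
        obtain ⟨a, b, c, hab, hac, hbc, hBeq⟩ := Finset.card_eq_three.1 hB3
        obtain ⟨w, hw0, hwa, hwb, hwc⟩ := exists_ne_zero_mem_commonKer_of_add_add_eq_zero
          (V := annihilating v) (by omega) (hne a (by simp [hBeq])) (hne b (by simp [hBeq]))
          (hne c (by simp [hBeq])) (fun M => by
            have := hann v hv M M.2
            rw [hBeq, Finset.sum_insert (by simp [hab, hac]), Finset.sum_pair hbc] at this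
            simp only [prodForm_restrictForms]
            linear_combination this)
        rw [mem_commonKer_restrictForms] at hwa hwb hwc
        refine hw0 (Subtype.ext (hN w fun i hi => ?_))
        simp only [hBeq, Finset.mem_insert, Finset.mem_singleton] at hi
        rcases hi with rfl | rfl | rfl <;> assumption
      · let e : Fin 4 ≃ B := (B.equivFinOfCardEq hB4).symm
        obtain ⟨A, hA1, hA2, hA⟩ := exists_subsum_prodForm_eq_zero (V := annihilating v) hdim
          (fun i => restrictForms (l (e i)) _) (fun M => by
            have := hann v hv M M.2
            rw [← Finset.sum_coe_sort, ← e.sum_comp] at this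
            simpa using this) (fun w hw => Subtype.ext (hN w fun i hi => by
              have := mem_commonKer_restrictForms.1 (hw (e.symm ⟨i, hi⟩))
              simpa using this))
        refine ⟨A.map (e.toEmbedding.trans (Function.Embedding.subtype _)), ⟨?_, ?_, ?_⟩, ?_⟩
        · intro i hi
          simp only [Finset.mem_map] at hi
          obtain ⟨j, -, rfl⟩ := hi
          exact (e j).2
        · exact Finset.card_pos.1 (by rw [Finset.card_map]; omega)
        · rwa [Finset.card_map]
        · intro M hM
          simpa using hA ⟨M, hM⟩)
  simp only [Finset.mem_filter, Finset.mem_powerset] at hA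
  exact hred A hA.1 hA.2.1 hA.2.2 hsing

end Determinant

/-! ### Product rank and tensor rank of the determinant -/

lemma update_vec_zero {α : Type*} (a b c x : α) :
    Function.update (![a, b, c] : Fin 3 → α) 0 x = ![x, b, c] := by
  ext i : 1; fin_cases i <;> rfl

lemma update_vec_one {α : Type*} (a b c x : α) :
    Function.update (![a, b, c] : Fin 3 → α) 1 x = ![a, x, c] := by
  ext i : 1; fin_cases i <;> rfl

lemma update_vec_two {α : Type*} (a b c x : α) :
    Function.update (![a, b, c] : Fin 3 → α) 2 x = ![a, b, x] := by
  ext i : 1; fin_cases i <;> rfl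

section Ranks

variable {K : Type*} [Field K]

lemma exists_dual_eval_eq {p : MvPolynomial (Fin 3 × Fin 3) K} (hp : p.IsHomogeneous 1) :
    ∃ f : Module.Dual K (Matrix (Fin 3) (Fin 3) K),
      ∀ M, f M = MvPolynomial.eval (fun ij => M ij.1 ij.2) p := by
  have hp' : p ∈ Submodule.span K (Set.range MvPolynomial.X) := by
    rw [← MvPolynomial.homogeneousSubmodule_one_eq_span_X]
    exact hp
  clear hp
  induction hp' using Submodule.span_induction with
  | mem x hx =>
    obtain ⟨ij, rfl⟩ := hx
    exact ⟨Matrix.entryLinearMap K K ij.1 ij.2, fun M => by simp⟩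
  | zero => exact ⟨0, fun M => by simp⟩
  | add x y _ _ hx hy =>
    obtain ⟨f, hf⟩ := hx
    obtain ⟨g, hg⟩ := hy
    exact ⟨f + g, fun M => by simp [hf, hg]⟩
  | smul c x _ hx =>
    obtain ⟨f, hf⟩ := hx
    exact ⟨c • f, fun M => by simp [hf]⟩

lemma eval_genericDet (n : ℕ) (M : Matrix (Fin n) (Fin n) K) :
    MvPolynomial.eval (fun ij => M ij.1 ij.2) (genericDet n K) = M.det := by
  rw [genericDet, RingHom.map_det]
  congr 1
  ext i j
  simp

lemma map_genericDet (n : ℕ) {F : Type*} [Field F] (φ : K →+* F) :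
    MvPolynomial.map φ (genericDet n K) = genericDet n F := by
  rw [genericDet, genericDet, RingHom.map_det]
  congr 1
  ext i j : 2
  simp

/-- The lower bound: an expression of `genericDet 3 K` as a sum of products of linear forms persists
over the algebraic closure. -/
lemma five_le_of_genericDet_eq_sum_prod {r : ℕ}
    {l : Fin r → Fin 3 → MvPolynomial (Fin 3 × Fin 3) K} (hl : ∀ i j, (l i j).IsHomogeneous 1)
    (h : genericDet 3 K = ∑ i, ∏ j, l i j) : 5 ≤ r := by
  by_contra hr
  have hφ := fun i j => exists_dual_eval_eq
    ((hl i j).map (algebraMap K (AlgebraicClosure K)))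
  choose f hf using hφ
  refine not_det_eq_sum_prodForm f Finset.univ (by rw [Finset.card_univ, Fintype.card_fin]; omega)
    fun M => ?_
  rw [← eval_genericDet, ← map_genericDet 3 (algebraMap K (AlgebraicClosure K)), h]
  simp [prodForm, hf]

/-- The multihomogeneous polynomial encoded by a tensor: `v₁ ⊗ ⋯ ⊗ vₙ` goes to
`∏ᵢ ∑ⱼ vᵢⱼ x_{ij}`. -/
noncomputable def tensorToForm (n : ℕ) (K : Type*) [Field K] :
    (⨂[K] _ : Fin n, (Fin n → K)) →ₗ[K] MvPolynomial (Fin n × Fin n) K :=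
  PiTensorProduct.lift ((MultilinearMap.mkPiAlgebra K (Fin n)
    (MvPolynomial (Fin n × Fin n) K)).compLinearMap
      fun i => Fintype.linearCombination K fun j => MvPolynomial.X (i, j))

lemma tensorToForm_tprod (n : ℕ) (v : Fin n → Fin n → K) :
    tensorToForm n K (PiTensorProduct.tprod K v) =
      ∏ i, ∑ j, v i j • (MvPolynomial.X (i, j) : MvPolynomial (Fin n × Fin n) K) := by
  simp [tensorToForm, Fintype.linearCombination_apply]

lemma tensorToForm_detTensor (n : ℕ) : tensorToForm n K (detTensor n K) = genericDet n K := by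
  rw [detTensor, genericDet, ← Matrix.det_transpose, Matrix.det_apply, map_sum]
  refine Finset.sum_congr rfl fun τ _ => ?_
  rw [map_smul, tensorToForm_tprod]
  simp [Pi.single_apply, ite_smul, Units.smul_def, Int.cast_smul_eq_zsmul]

lemma exists_genericDet_eq_sum_of_detTensor_eq_sum {r : ℕ} {v : Fin r → ∀ _ : Fin 3, (Fin 3 → K)}
    (h : detTensor 3 K = ∑ p, PiTensorProduct.tprod K (v p)) :
    ∃ l : Fin r → Fin 3 → MvPolynomial (Fin 3 × Fin 3) K,
      (∀ i j, (l i j).IsHomogeneous 1) ∧ genericDet 3 K = ∑ i, ∏ j, l i j := by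
  refine ⟨fun p i => ∑ j, v p i j • MvPolynomial.X (i, j), fun p i => ?_, ?_⟩
  · refine MvPolynomial.IsHomogeneous.sum _ _ _ fun j _ => ?_
    rw [MvPolynomial.smul_eq_C_mul]
    exact MvPolynomial.isHomogeneous_C_mul_X _ _
  · rw [← tensorToForm_detTensor, h, map_sum]
    exact Finset.sum_congr rfl fun p _ => tensorToForm_tprod 3 (v p)

/-- The simple tensor `a ⊗ b ⊗ c`. -/
noncomputable def simpleTensor (a b c : Fin 3 → K) : ⨂[K] _ : Fin 3, (Fin 3 → K) :=
  PiTensorProduct.tprod K ![a, b, c]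

lemma simpleTensor_add_left (a a' b c : Fin 3 → K) :
    simpleTensor (a + a') b c = simpleTensor a b c + simpleTensor a' b c := by
  have key := (PiTensorProduct.tprod K).map_update_add (![a, b, c]) 0 a a'
  simp only [update_vec_zero] at key
  exact key

lemma simpleTensor_add_mid (a b b' c : Fin 3 → K) :
    simpleTensor a (b + b') c = simpleTensor a b c + simpleTensor a b' c := by
  have key := (PiTensorProduct.tprod K).map_update_add (![a, b, c]) 1 b b'
  simp only [update_vec_one] at key
  exact key

lemma simpleTensor_add_right (a b c c' : Fin 3 → K) :
    simpleTensor a b (c + c') = simpleTensor a b c + simpleTensor a b c' := by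
  have key := (PiTensorProduct.tprod K).map_update_add (![a, b, c]) 2 c c'
  simp only [update_vec_two] at key
  exact key

lemma simpleTensor_neg_left (a b c : Fin 3 → K) :
    simpleTensor (-a) b c = -simpleTensor a b c := by
  have key := (PiTensorProduct.tprod K).map_update_neg (![a, b, c]) 0 a
  simp only [update_vec_zero] at key
  exact key

lemma simpleTensor_neg_mid (a b c : Fin 3 → K) :
    simpleTensor a (-b) c = -simpleTensor a b c := by
  have key := (PiTensorProduct.tprod K).map_update_neg (![a, b, c]) 1 b
  simp only [update_vec_one] at key
  exact key

lemma detTensor_three : detTensor 3 K =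
    simpleTensor (Pi.single 0 1) (Pi.single 1 1) (Pi.single 2 1)
    - simpleTensor (Pi.single 0 1) (Pi.single 2 1) (Pi.single 1 1)
    - simpleTensor (Pi.single 1 1) (Pi.single 0 1) (Pi.single 2 1)
    + simpleTensor (Pi.single 1 1) (Pi.single 2 1) (Pi.single 0 1)
    + simpleTensor (Pi.single 2 1) (Pi.single 0 1) (Pi.single 1 1)
    - simpleTensor (Pi.single 2 1) (Pi.single 1 1) (Pi.single 0 1) := by
  have hsimple : ∀ τ : Equiv.Perm (Fin 3), PiTensorProduct.tprod K
      (fun i => (Pi.single (τ i) 1 : Fin 3 → K)) =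
        simpleTensor (Pi.single (τ 0) 1) (Pi.single (τ 1) 1) (Pi.single (τ 2) 1) := fun τ => by
    refine congrArg _ ?_
    ext i : 1
    fin_cases i <;> rfl
  simp only [detTensor, hsimple]
  have hperm : (Finset.univ : Finset (Equiv.Perm (Fin 3))) =
      {1, Equiv.swap 1 2, Equiv.swap 0 1, Equiv.swap 0 1 * Equiv.swap 1 2,
        Equiv.swap 1 2 * Equiv.swap 0 1, Equiv.swap 0 2} := by decide
  rw [hperm, Finset.sum_insert (by decide), Finset.sum_insert (by decide),
    Finset.sum_insert (by decide), Finset.sum_insert (by decide), Finset.sum_insert (by decide),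
    Finset.sum_singleton]
  have hneg : ∀ t : ⨂[K] _ : Fin 3, (Fin 3 → K), (-1 : K) • t = -t := fun t => neg_one_smul K t
  simp [Equiv.swap_apply_def, hneg]
  abel

/-- An expression of the determinant tensor with five terms, valid in every characteristic. -/
lemma detTensor_three_eq_sum_five : ∃ v : Fin 5 → ∀ _ : Fin 3, (Fin 3 → K),
    detTensor 3 K = ∑ p, PiTensorProduct.tprod K (v p) := by
  let x : Fin 3 → K := Pi.single 0 1
  let y : Fin 3 → K := Pi.single 1 1
  let z : Fin 3 → K := Pi.single 2 1
  refine ⟨![![-y, x + z, z], ![z, x + y, y], ![x + y, z, x + z], ![-(x + z), y, x + y],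
    ![x, y + -z, x + y + z]], ?_⟩
  have h : detTensor 3 K = simpleTensor (-y) (x + z) z + simpleTensor z (x + y) y
      + simpleTensor (x + y) z (x + z) + simpleTensor (-(x + z)) y (x + y)
      + simpleTensor x (y + -z) (x + y + z) := by
    rw [detTensor_three]
    simp only [simpleTensor_neg_left, simpleTensor_neg_mid, simpleTensor_add_left,
      simpleTensor_add_mid, simpleTensor_add_right]
    simp only [x, y, z]
    abel
  rw [h]
  simp [Fin.sum_univ_five, simpleTensor]

end Ranks

theorem mainTheorem7 (K : Type*) [Field K] :
    productRank 3 (genericDet 3 K) = 5 ∧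
    tensorRank (detTensor 3 K) = 5 ∧
    (IsAlgClosed K → FanoIsSplit K 5 4 3 2) := by
  obtain ⟨v, hv⟩ := detTensor_three_eq_sum_five (K := K)
  refine ⟨le_antisymm (Nat.sInf_le (exists_genericDet_eq_sum_of_detTensor_eq_sum hv)) ?_,
    le_antisymm (Nat.sInf_le ⟨v, hv⟩) ?_, fun _ => ?_⟩
  · refine le_csInf ⟨5, exists_genericDet_eq_sum_of_detTensor_eq_sum hv⟩ ?_
    rintro r ⟨l, hl, h⟩
    exact five_le_of_genericDet_eq_sum_prod hl h
  · refine le_csInf ⟨5, v, hv⟩ ?_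
    rintro r ⟨v, hv⟩
    obtain ⟨l, hl, h⟩ := exists_genericDet_eq_sum_of_detTensor_eq_sum hv
    exact five_le_of_genericDet_eq_sum_prod hl h
  · have : Infinite K := IsAlgClosed.instInfinite
    exact fanoIsSplit_five_four_three_two K
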